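/- A team of $p$ players $P_1,\dots,P_p$ and a distribution type $\bar s=(s_1,\dots,s_p)\in\mathbb N^p$ are given; put $|\bar s|=\sum_i s_i$. A deal of type $\bar s$ is a partition $H=(H_1,\dots,H_p)$ of the deck $\{1,\dots,|\bar s|\}$ into hands (possibly empty) with $\# H_i=s_i$. An action is either the announcement of a set of deals or the action END. A run is a finite sequence of actions; it is terminal if its last action is END, and proper if END does not occur in it except possibly at the end. A protocol $\pi$ assigns to each deal $H$ and each non-terminal proper run $\rho$ a non-empty set $\pi(H,\rho)$ of actions such that every announcement $\alpha\in\pi(H,\rho)$ satisfies $H\in\alpha$, and such that $\pi(H,\rho)=\pi(H',\rho)$ whenever $H_i=H'_i$, where $P_i$ is the player whose turn it is, i.e. $i\in\{1,\dots,p\}$ and $i\equiv|\rho|+1 \pmod p$. A pair $(H,\rho)$ with $\rho=\alpha_1,\dots,\alpha_n$ is an execution of $\pi$ if $\alpha_{j+1}\in\pi(H,(\alpha_1,\dots,\alpha_j))$ for all $j<n$; infinite executions are defined in the same way. The protocol $\pi$ is terminating if it has no infinite execution; informative if for every execution $(H,\rho)$ with $\rho$ terminal and every player $P_i$ there is no execution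 $(H',\rho)$ with $H'\ne H$ and $H'_i=H_i$; and safe if for every execution $(H,\rho)$, every card $c$ and the player $P_i$ with $c\in H_i$ there is an execution $(H',\rho)$ with $c\notin H'_i$. The problem of secure aggregation of distributed information (SADI) for $\bar s$ is solvable if there is a terminating, informative and safe protocol for $\bar s$. Theorem (Unrestricted solvability). For every natural number $m$ there is $N$ such that, whenever $\bar s$ is a distribution type over at least two and at most $m$ players with $|\bar s|>N$, and each player holds at least $\frac12\sqrt{|\bar s|/m}$ cards, the SADI problem for $\bar s$ is solvable. -/

import Mathlib

namespace SADI

/-- A deal of type `s` over the deck `C`: the hands `hand P` are pairwise disjoint, together they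
make up the deck, and player `P` holds exactly `s P` cards. -/
@[ext]
structure Deal {p : ℕ} (s : Fin p → ℕ) (C : Type) where
  /-- the hand of each player -/
  hand : Fin p → Finset C
  card_hand : ∀ P, (hand P).card = s P
  existsUnique_owner : ∀ c : C, ∃! P, c ∈ hand P

/-- An action: either the public announcement of a set of deals, or the action `finish`, which ends
the communication. -/
inductive Action {p : ℕ} (s : Fin p → ℕ) (C : Type) where
  | announce : Set (Deal s C) → Action s C
  | finish : Action s C

/-- A (finite) run is a finite sequence of actions, in chronological order. -/
abbrev Run {p : ℕ} (s : Fin p → ℕ) (C : Type) := List (Action s C)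

section
variable {p : ℕ} {s : Fin p → ℕ} {C : Type}

/-- A run is terminal if its last action is `finish`. -/
def Run.IsTerminal (ρ : Run s C) : Prop := ρ.getLast? = some Action.finish

/-- A run is proper if `finish` does not occur in it, except possibly as its last action. -/
def Run.IsProper (ρ : Run s C) : Prop := Action.finish ∉ ρ.dropLast

end

/-- A protocol assigns to every deal and every non-terminal proper run a non-empty set of actions,
out of which the player whose turn it is chooses one. Announcements have to be true, and the set of
actions may depend only on the run and on the hand of the player whose turn it is. The players move
cyclically, in the order of their indices. (Values of `act` at other runs are never used.) -/
structure Protocol {p : ℕ} (s : Fin p → ℕ) (C : Type) where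
  /-- the set of actions that are allowed next -/
  act : Deal s C → Run s C → Set (Action s C)
  nonempty : ∀ (H : Deal s C) (ρ : Run s C), ρ.IsProper → ¬ ρ.IsTerminal → (act H ρ).Nonempty
  truthful : ∀ (H : Deal s C) (ρ : Run s C), ρ.IsProper → ¬ ρ.IsTerminal →
    ∀ S : Set (Deal s C), Action.announce S ∈ act H ρ → H ∈ S
  local_info : ∀ (H H' : Deal s C) (ρ : Run s C), ρ.IsProper → ¬ ρ.IsTerminal →
    ∀ P : Fin p, (P : ℕ) = ρ.length % p → H.hand P = H'.hand P → act H ρ = act H' ρ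

namespace Protocol
variable {p : ℕ} {s : Fin p → ℕ} {C : Type} (π : Protocol s C)

/-- `(H, ρ)` is an execution of `π`: each action of `ρ` is one of those that `π` allows after the
preceding ones (which must form a non-terminal proper run). -/
def IsExecution (H : Deal s C) (ρ : Run s C) : Prop :=
  ∀ (i : ℕ) (hi : i < ρ.length),
    Run.IsProper (ρ.take i) ∧ ¬ Run.IsTerminal (ρ.take i) ∧ ρ[i] ∈ π.act H (ρ.take i)

/-- `π` is terminating: it has no infinite executions. -/
def Terminating : Prop :=
  ¬ ∃ (H : Deal s C) (α : ℕ → Action s C), ∀ n : ℕ, π.IsExecution H ((List.range n).map α)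

/-- The execution `(H, ρ)` is informative for player `P`. -/
def InformativeFor (H : Deal s C) (ρ : Run s C) (P : Fin p) : Prop :=
  ¬ ∃ H' : Deal s C, π.IsExecution H' ρ ∧ H' ≠ H ∧ H.hand P = H'.hand P

/-- `π` is informative: after every terminal execution each player knows the deal. -/
def Informative : Prop :=
  ∀ (H : Deal s C) (ρ : Run s C), π.IsExecution H ρ → ρ.IsTerminal →
    ∀ P : Fin p, π.InformativeFor H ρ P

/-- The eavesdropper's ignorance set: the deals that are compatible with the run `ρ`. -/
def ignorance (ρ : Run s C) : Set (Deal s C) := {H | π.IsExecution H ρ}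

/-- The execution `(H, ρ)` is safe for the card `c`. -/
def SafeFor (H : Deal s C) (ρ : Run s C) (c : C) : Prop :=
  ∀ P : Fin p, c ∈ H.hand P → ∃ H' ∈ π.ignorance ρ, c ∉ H'.hand P

/-- `π` is (card-)safe: every execution, terminal or not, is safe for every card. -/
def Safe : Prop :=
  ∀ (H : Deal s C) (ρ : Run s C), π.IsExecution H ρ → ∀ c : C, π.SafeFor H ρ c

end Protocol

/-- The problem with distribution type `s`, over the standard deck of `∑ P, s P` cards, has a
terminating protocol that is informative and safe. -/
def Solvable {p : ℕ} (s : Fin p → ℕ) : Prop :=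
  ∃ π : Protocol s (Fin (∑ P, s P)), π.Terminating ∧ π.Informative ∧ π.Safe

end SADI

/-! The players create a common secret `i` with `k + 1` possible values that the eavesdropper never
learns. A player `A` with a largest hand announces a block made of `k` of his cards and one foreign
card; the owner `Q` of the latter reports. Then `A` and `Q` know its position `i`, while to the
public all `k + 1` positions remain possible. From then on, whoever knows `i` can announce a block
whose foreign card is in position `i`, and its owner learns `i` too (`Win.step`).

Once everybody knows `i`, the unused cards are settled in one go (`Win.of_forall_know`): `A`
publishes `k + 1` permutations of them, such that the `i`-th one encodes the deal and every card
goes to `A` under some of them but not under all. One deal per value of `i` remains. Hence players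
know the deal, and no card has a publicly known owner.

Nobody controls who owns the foreign card, so a game of hand sizes against an adversary remains
(`Playable`): the secret has to reach everyone while the unused cards of `A` and of the others stay
within a factor `k` of each other. If `A` does not dominate overwhelmingly, a moderate `k` works,
with informed players other than `A` spending their cards first whenever `A` is in the minority
(`Playable.of_small_blocks`). Otherwise `k` is about the ratio of the hand of `A` to the rest, and
`A` announces all blocks (`Playable.of_majority`). The square root bound makes one of the two apply
(`solvable_of_bounds`). -/

namespace SADI

section
variable {p : ℕ} {s : Fin p → ℕ} {C : Type}

/-! ### Deals as owner functions -/

namespace Deal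

/-- The player who holds the card `c`. -/
noncomputable def owner (H : Deal s C) (c : C) : Fin p := (H.existsUnique_owner c).choose

theorem mem_hand_iff (H : Deal s C) (c : C) (P : Fin p) : c ∈ H.hand P ↔ H.owner c = P := by
  have h := (H.existsUnique_owner c).choose_spec
  constructor
  · intro hc
    exact (h.2 P hc).symm
  · rintro rfl
    exact h.1

theorem ext_owner {H H' : Deal s C} (h : ∀ c, H.owner c = H'.owner c) : H = H' := by
  ext P c
  rw [mem_hand_iff, mem_hand_iff, h]

theorem card_filter_owner [Fintype C] (H : Deal s C) (P : Fin p) :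
    (Finset.univ.filter fun c => H.owner c = P).card = s P := by
  rw [← H.card_hand P]
  congr 1
  ext c
  simp [mem_hand_iff]

/-- The deal with a prescribed owner of each card. -/
def ofOwner [Fintype C] (o : C → Fin p)
    (ho : ∀ P, (Finset.univ.filter fun c => o c = P).card = s P) : Deal s C where
  hand P := Finset.univ.filter fun c => o c = P
  card_hand := ho
  existsUnique_owner c := ⟨o c, by simp, fun P hP => by simpa [eq_comm] using hP⟩

theorem owner_ofOwner [Fintype C] (o : C → Fin p)
    (ho : ∀ P, (Finset.univ.filter fun c => o c = P).card = s P) (c : C) :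
    (ofOwner o ho).owner c = o c := by
  rw [← mem_hand_iff]
  simp [ofOwner]

end Deal

/-- Within the set `K` of publicly possible deals, each hand determines the deal. -/
def InformativeOn (K : Set (Deal s C)) : Prop :=
  ∀ H ∈ K, ∀ H' ∈ K, ∀ P, H.hand P = H'.hand P → H = H'

/-- Within the set `K` of publicly possible deals, no card has a publicly known owner. -/
def SafeOn (K : Set (Deal s C)) : Prop :=
  ∀ H ∈ K, ∀ c P, c ∈ H.hand P → ∃ H' ∈ K, c ∉ H'.hand P

/-- The set of the deals in which the hand of `P` belongs to `S`. -/
def handIn (P : Fin p) (S : Set (Finset C)) : Set (Deal s C) := {H | H.hand P ∈ S}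

end

/-! ### Strategy trees and the protocols that follow them -/

/-- A strategy tree: either the communication ends, or the player `P` announces that his hand
belongs to some member of the family `F`, and the communication goes on depending on it. -/
inductive Strat (p : ℕ) (C : Type) : Type
  | finish : Strat p C
  | announce (P : Fin p) (F : Set (Set (Finset C))) (next : Set (Finset C) → Strat p C) : Strat p C

namespace Strat
variable {p : ℕ} {s : Fin p → ℕ} {C : Type}

/-- The strategy `σ` solves the problem when `K` is the set of publicly possible deals. -/
def Valid : Strat p C → Set (Deal s C) → Prop
  | finish, K => InformativeOn K ∧ SafeOn K
  | announce P F next, K => (∀ H ∈ K, ∃ S ∈ F, H.hand P ∈ S) ∧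
      ∀ S ∈ F, Valid (next S) (K ∩ handIn P S)

theorem valid_empty (σ : Strat p C) : σ.Valid (∅ : Set (Deal s C)) := by
  induction σ with
  | finish => simp [Valid, InformativeOn, SafeOn]
  | announce P F next ih =>
    refine ⟨by simp, fun S _ => ?_⟩
    rw [Set.empty_inter]
    exact ih S

/-- Safety is demanded only at the leaves: announcements shrink the set of possible deals, so a
witness found later is a witness now. -/
theorem Valid.safeOn {σ : Strat p C} {K : Set (Deal s C)} (h : σ.Valid K) : SafeOn K := by
  induction σ generalizing K with
  | finish => exact h.2
  | announce P F next ih =>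
    intro H hH c Q hc
    obtain ⟨S, hS, hHS⟩ := h.1 H hH
    obtain ⟨H', hH', hc'⟩ := ih S (h.2 S hS) H ⟨hH, hHS⟩ c Q hc
    exact ⟨H', hH'.1, hc'⟩

open Classical in
/-- The strategy that remains after the action `a` at time `n`. -/
noncomputable def next (s : Fin p → ℕ) : Strat p C → ℕ → Action s C → Strat p C
  | announce P F nx, n, Action.announce T =>
      if (P : ℕ) = n % p then
        (if h : ∃ S ∈ F, T = handIn P S then nx h.choose else finish)
      else announce P F nx
  | σ, _, _ => σ

open Classical in
/-- The actions that the strategy allows at time `n`. Players whose turn it is not according to the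
strategy tree make a void announcement. -/
noncomputable def act : Strat p C → ℕ → Deal s C → Set (Action s C)
  | finish, _, _ => {Action.finish}
  | announce P F _, n, H =>
      if (P : ℕ) = n % p ∧ ∃ S ∈ F, H.hand P ∈ S then
        {a | ∃ S ∈ F, H.hand P ∈ S ∧ a = Action.announce (handIn P S)}
      else {Action.announce Set.univ}

/-- The strategy that remains after a run. -/
noncomputable def after (σ : Strat p C) (ρ : Run s C) : Strat p C :=
  (ρ.foldl (fun x a => (x.1.next s x.2 a, x.2 + 1)) (σ, 0)).1

theorem foldl_snd (σ : Strat p C) (ρ : Run s C) (n : ℕ) :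
    (ρ.foldl (fun x a => (x.1.next s x.2 a, x.2 + 1)) (σ, n)).2 = n + ρ.length := by
  induction ρ generalizing σ n with
  | nil => simp
  | cons a ρ ih => simp only [List.foldl_cons, ih, List.length_cons]; omega

theorem after_append (σ : Strat p C) (ρ : Run s C) (a : Action s C) :
    σ.after (ρ ++ [a]) = (σ.after ρ).next s ρ.length a := by
  have := foldl_snd σ ρ 0
  simp only [after, List.foldl_append, List.foldl_cons, List.foldl_nil, this, zero_add]

theorem act_nonempty (σ : Strat p C) (n : ℕ) (H : Deal s C) : (σ.act n H).Nonempty := by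
  cases σ with
  | finish => exact ⟨_, rfl⟩
  | announce P F nx =>
    rw [act]
    split_ifs with h
    · obtain ⟨-, S, hS, hH⟩ := h
      exact ⟨_, S, hS, hH, rfl⟩
    · exact ⟨_, rfl⟩

theorem mem_of_announce_mem_act (σ : Strat p C) (n : ℕ) (H : Deal s C) (T : Set (Deal s C))
    (h : Action.announce T ∈ σ.act n H) : H ∈ T := by
  cases σ with
  | finish => simp [act] at h
  | announce P F nx =>
    rw [act] at h
    split_ifs at h
    · obtain ⟨S, -, hH, hT⟩ := h
      cases hT
      exact hH
    · cases h
      trivial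

theorem act_congr (σ : Strat p C) (n : ℕ) (H H' : Deal s C) (P : Fin p) (hP : (P : ℕ) = n % p)
    (h : H.hand P = H'.hand P) : σ.act n H = σ.act n H' := by
  cases σ with
  | finish => rfl
  | announce Q F nx =>
    rw [act, act]
    by_cases hQ : (Q : ℕ) = n % p
    · obtain rfl : P = Q := Fin.ext (hP.trans hQ.symm)
      rw [h]
    · simp [hQ]

/-- The protocol that follows a strategy tree. -/
noncomputable def protocol (s : Fin p → ℕ) (σ : Strat p C) : Protocol s C where
  act H ρ := (σ.after ρ).act ρ.length H
  nonempty _ _ _ _ := act_nonempty _ _ _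
  truthful _ _ _ _ _ hT := mem_of_announce_mem_act _ _ _ _ hT
  local_info _ _ _ _ _ P hP h := act_congr _ _ _ _ P hP h

end Strat

section
variable {p : ℕ} {s : Fin p → ℕ} {C : Type}

theorem Protocol.isExecution_append (π : Protocol s C) (H : Deal s C) (ρ : Run s C)
    (a : Action s C) : π.IsExecution H (ρ ++ [a]) ↔
      π.IsExecution H ρ ∧ ρ.IsProper ∧ ¬ ρ.IsTerminal ∧ a ∈ π.act H ρ := by
  constructor
  · intro h
    refine ⟨fun i hi => ?_, ?_⟩
    · have := h i (by simp; omega)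
      rwa [List.take_append_of_le_length hi.le, List.getElem_append_left hi] at this
    · simpa using h ρ.length (by simp)
  · rintro ⟨h, h'⟩ i hi
    rcases Nat.lt_succ_iff_lt_or_eq.1 (by simpa using hi) with hi' | rfl
    · rw [List.take_append_of_le_length hi'.le, List.getElem_append_left hi']
      exact h i hi'
    · simpa using h'

theorem not_isTerminal_of_notMem {ρ : Run s C} (h : Action.finish ∉ ρ) : ¬ ρ.IsTerminal :=
  fun h' => h (List.mem_of_getLast? h')

theorem isProper_of_notMem {ρ : Run s C} (h : Action.finish ∉ ρ) : ρ.IsProper :=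
  fun h' => h (List.mem_of_mem_dropLast h')

theorem notMem_of_isProper {ρ : Run s C} (h : ρ.IsProper) (h' : ¬ ρ.IsTerminal) :
    Action.finish ∉ ρ := by
  induction ρ using List.reverseRecOn with
  | nil => simp
  | append_singleton ρ a _ =>
    simp only [Run.IsProper, List.dropLast_concat] at h
    simp only [Run.IsTerminal, List.getLast?_concat, Option.some.injEq] at h'
    simp [h, Ne.symm h']

namespace Strat

/-- If `σ` solves the problem, then what remains of it after a run solves the problem for the
deals that are compatible with the run. -/
theorem valid_after {σ : Strat p C} (hσ : σ.Valid (Set.univ : Set (Deal s C))) (ρ : Run s C)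
    (hρ : Action.finish ∉ ρ) :
    (σ.after ρ).Valid {H | (σ.protocol s).IsExecution H ρ} := by
  induction ρ using List.reverseRecOn with
  | nil =>
    have : {H | (σ.protocol s).IsExecution H []} = Set.univ := by
      ext H; simp [Protocol.IsExecution]
    rw [this]
    exact hσ
  | append_singleton ρ a ih =>
    simp only [List.mem_append, List.mem_singleton, not_or] at hρ
    have ih := ih hρ.1
    have hset : {H | (σ.protocol s).IsExecution H (ρ ++ [a])} =
        {H | (σ.protocol s).IsExecution H ρ} ∩ {H | a ∈ (σ.after ρ).act ρ.length H} := by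
      ext H
      simp only [Protocol.isExecution_append, Set.mem_ofPred_eq, Set.mem_inter_iff,
        isProper_of_notMem hρ.1, not_isTerminal_of_notMem hρ.1, not_false_eq_true, true_and]
      rfl
    rw [hset, after_append]
    generalize {H | (σ.protocol s).IsExecution H ρ} = K at ih ⊢
    generalize σ.after ρ = τ at ih ⊢
    -- An action that no compatible deal allows leaves no deals, so the default values in `next` are
    -- harmless.
    have hempty : ∀ τ' : Strat p C, (∀ H ∈ K, a ∉ τ.act ρ.length H) →
        τ'.Valid (K ∩ {H | a ∈ τ.act ρ.length H}) := by
      intro τ' h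
      convert valid_empty τ'
      ext H
      simpa using h H
    cases τ with
    | finish => exact hempty _ fun H _ hH => hρ.2 (Eq.symm (by simpa [act] using hH))
    | announce P F nx =>
      obtain _ | T := a
      rotate_left
      · exact absurd rfl hρ.2
      rename_i T
      by_cases hP : (P : ℕ) = ρ.length % p
      · have hact : ∀ H ∈ K, Action.announce T ∈ (announce P F nx).act ρ.length H ↔
            ∃ S ∈ F, H.hand P ∈ S ∧ T = handIn P S := by
          intro H hH
          rw [act]
          rw [if_pos ⟨hP, ih.1 H hH⟩]
          simp
        by_cases hT : ∃ S ∈ F, T = handIn P S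
        · have hn : (announce P F nx).next s ρ.length (Action.announce T) = nx hT.choose := by
            simp only [next, if_pos hP, dif_pos hT]
          rw [hn]
          have hc := hT.choose_spec
          convert ih.2 _ hc.1 using 1
          ext H
          simp only [Set.mem_inter_iff, Set.mem_ofPred_eq]
          refine and_congr_right fun hH => ?_
          rw [hact H hH, ← hc.2]
          constructor
          · rintro ⟨S, -, hS, rfl⟩
            exact hS
          · intro h
            exact ⟨_, hc.1, by rw [hc.2] at h; exact h, hc.2⟩
        · apply hempty
          intro H hH h
          rw [hact H hH] at h
          obtain ⟨S, hS, -, rfl⟩ := h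
          exact hT ⟨S, hS, rfl⟩
      · have hact : ∀ H : Deal s C, (announce P F nx).act ρ.length H =
            {Action.announce Set.univ} := by
          intro H
          rw [act]
          rw [if_neg fun h => hP h.1]
        have hn : (announce P F nx).next s ρ.length (Action.announce T) = announce P F nx := by
          simp only [next, if_neg hP]
        by_cases hT : T = Set.univ
        · rw [hn]
          convert ih using 1
          ext H
          simp [hact, hT]
        · apply hempty
          intro H _ h
          rw [hact] at h
          cases h
          exact hT rfl

/-- Induction on the tree: each node waits only until the turn of its player, and then the run
passes to a subtree. -/
theorem protocol_terminating (hp : 0 < p) (σ : Strat p C) : (σ.protocol s).Terminating := by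
  rintro ⟨H, α, hα⟩
  have happ : ∀ n, (List.range (n + 1)).map α = (List.range n).map α ++ [α n] := by
    intro n; simp [List.range_succ]
  have hstep : ∀ n, α n ∈ (σ.after ((List.range n).map α)).act n H := by
    intro n
    have := hα (n + 1)
    rw [happ, Protocol.isExecution_append] at this
    simpa [protocol] using this.2.2.2
  have hfin : ∀ n, α n ≠ Action.finish := by
    intro n h
    have := hα (n + 1 + 1)
    rw [happ, Protocol.isExecution_append] at this
    apply this.2.2.1
    rw [happ, h]
    simp [Run.IsTerminal]
  have key : ∀ (τ : Strat p C) (n : ℕ), σ.after ((List.range n).map α) = τ → False := by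
    intro τ
    induction τ with
    | finish =>
      intro n hn
      have := hstep n
      rw [hn] at this
      exact hfin n (by simpa [act] using this)
    | announce P F nx ih =>
      have hnext : ∀ n, σ.after ((List.range n).map α) = announce P F nx →
          (P : ℕ) ≠ n % p ∧ σ.after ((List.range (n + 1)).map α) = announce P F nx := by
        intro n hn
        have hs : σ.after ((List.range (n + 1)).map α) =
            (announce P F nx).next s n (α n) := by
          rw [happ, after_append, hn]
          simp
        cases hα' : α n with
        | finish => exact absurd hα' (hfin n)
        | announce T =>
          rw [hα'] at hs
          by_cases hP : (P : ℕ) = n % p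
          · exfalso
            simp only [next, if_pos hP] at hs
            split_ifs at hs with h
            · exact ih _ (n + 1) hs
            · have := hstep (n + 1)
              rw [hs] at this
              exact hfin (n + 1) (by simpa [act] using this)
          · simp only [next, if_neg hP] at hs
            exact ⟨hP, hs⟩
      intro n hn
      have hall : ∀ d, σ.after ((List.range (n + d)).map α) = announce P F nx := by
        intro d
        induction d with
        | zero => exact hn
        | succ d ihd => exact (hnext _ ihd).2
      -- Time `n * p + P` is not before `n`, and it is the turn of `P`.
      have hle : n ≤ n * p := Nat.le_mul_of_pos_right n hp
      have := (hnext _ (hall (n * p - n + P))).1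
      apply this
      rw [show n + (n * p - n + P) = P + n * p by omega, Nat.add_mul_mod_self_right,
        Nat.mod_eq_of_lt P.2]
  exact key _ 0 rfl

end Strat

/-! ### Winning strategies on sets of deals -/

/-- There is a strategy that solves the problem when `K` is the set of publicly possible deals. -/
def Win (K : Set (Deal s C)) : Prop := ∃ σ : Strat p C, σ.Valid K

theorem Win.final {K : Set (Deal s C)} (h : InformativeOn K) (h' : SafeOn K) : Win K :=
  ⟨Strat.finish, h, h'⟩

theorem Win.announce {K : Set (Deal s C)} (P : Fin p) (F : Set (Set (Finset C)))
    (hF : ∀ H ∈ K, ∃ S ∈ F, H.hand P ∈ S) (h : ∀ S ∈ F, Win (K ∩ handIn P S)) : Win K := by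
  have : Nonempty (Strat p C) := ⟨Strat.finish⟩
  choose! g hg using h
  exact ⟨Strat.announce P F g, hF, hg⟩

theorem Win.claims_aux {α : Type} {K : Set (Deal s C)} (f : Fin p → Finset C → α)
    (l : List (Fin p)) (h : ∀ H ∈ K, Win {H' ∈ K | ∀ P ∈ l, f P (H'.hand P) = f P (H.hand P)})
    (h0 : ∀ K' ⊆ K, K' = ∅ → Win K') : Win K := by
  induction l generalizing K with
  | nil =>
    by_cases hK : K = ∅
    · exact h0 K subset_rfl hK
    · obtain ⟨H, hH⟩ := Set.nonempty_iff_ne_empty.2 hK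
      simpa using h H hH
  | cons P l ih =>
    refine Win.announce P (Set.range fun a : α => {x | f P x = a})
      (fun H _ => ⟨_, ⟨_, rfl⟩, rfl⟩) ?_
    rintro _ ⟨a, rfl⟩
    refine ih (fun H hH => ?_) fun K' hK' => h0 K' (hK'.trans Set.inter_subset_left)
    convert h H hH.1 using 1
    have ha : f P (H.hand P) = a := hH.2
    ext H'
    simp only [Set.mem_inter_iff, Set.mem_ofPred_eq, List.forall_mem_cons, handIn, ha]
    tauto

/-- If every player `P` announces the value of `f P` at his hand, then it suffices to solve the
problem for each of the possible outcomes. -/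
theorem Win.claims {α : Type} {K : Set (Deal s C)} (f : Fin p → Finset C → α)
    (h : ∀ H ∈ K, Win {H' ∈ K | ∀ P, f P (H'.hand P) = f P (H.hand P)}) : Win K := by
  refine Win.claims_aux f (List.finRange p) (by simpa using h) ?_
  rintro _ _ rfl
  exact ⟨Strat.finish, Strat.valid_empty _⟩

/-- Only leaves allow `finish`, and they allow it for every deal. Thus a terminal run has the same
compatible deals as the run before its last action, and validity of the leaf applies. -/
theorem Solvable.of_win (hp : 0 < p)
    (h : Win (Set.univ : Set (Deal s (Fin (∑ P, s P))))) : Solvable s := by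
  obtain ⟨σ, hσ⟩ := h
  refine ⟨σ.protocol s, σ.protocol_terminating hp, ?_, ?_⟩
  · rintro H ρ hρ hterm P ⟨H', hρ', hne, hP⟩
    induction ρ using List.reverseRecOn with
    | nil => simp [Run.IsTerminal] at hterm
    | append_singleton ρ a _ =>
      obtain rfl : a = Action.finish := by simpa [Run.IsTerminal] using hterm
      rw [Protocol.isExecution_append] at hρ hρ'
      have hv := Strat.valid_after hσ ρ (notMem_of_isProper hρ.2.1 hρ.2.2.1)
      have ha : Action.finish ∈ (σ.after ρ).act ρ.length H := hρ.2.2.2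
      cases hτ : σ.after ρ with
      | finish =>
        rw [hτ] at hv
        exact hne (hv.1 H hρ.1 H' hρ'.1 P hP).symm
      | announce Q F nx =>
        rw [hτ] at ha
        rw [Strat.act] at ha
        split_ifs at ha
        · obtain ⟨S, -, -, hS⟩ := ha
          cases hS
        · cases ha
  · intro H ρ hρ c P hc
    by_cases hfin : Action.finish ∈ ρ
    · induction ρ using List.reverseRecOn with
      | nil => simp at hfin
      | append_singleton ρ a _ =>
        rw [Protocol.isExecution_append] at hρ
        have hn := notMem_of_isProper hρ.2.1 hρ.2.2.1
        obtain rfl : Action.finish = a := by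
          simpa [hn] using hfin
        have hv := Strat.valid_after hσ ρ hn
        obtain ⟨H', hH', hc'⟩ := hv.safeOn H hρ.1 c P hc
        refine ⟨H', ?_, hc'⟩
        have ha : Action.finish ∈ (σ.after ρ).act ρ.length H := hρ.2.2.2
        refine (Protocol.isExecution_append _ _ _ _).2 ⟨hH', hρ.2.1, hρ.2.2.1, ?_⟩
        change Action.finish ∈ (σ.after ρ).act ρ.length H'
        cases hτ : σ.after ρ with
        | finish => rfl
        | announce Q F nx =>
          rw [hτ] at ha
          rw [Strat.act] at ha
          split_ifs at ha
          · obtain ⟨S, -, -, hS⟩ := ha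
            cases hS
          · cases ha
    · exact (Strat.valid_after hσ ρ hfin).safeOn H hρ c P hc

end

end SADI

/-! ### Blocks and the common secret -/

namespace SADI

section
variable {p : ℕ} {s : Fin p → ℕ} {C : Type} [DecidableEq C] {k : ℕ}

/-- The deals that follow, for some value `i` of the common secret, the pattern `own i` outside the
set `R` of cards that have not been used yet. -/
def possible (s : Fin p → ℕ) (own : Fin (k + 1) → C → Fin p) (R : Finset C) : Set (Deal s C) :=
  {H | ∃ i, ∀ c ∉ R, H.owner c = own i c}

/-- The invariants of the communication: `R` is the set of cards that have not been used yet, of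
which player `P` holds `t P`; the other cards follow one of the patterns `own i`, and the players
in `J` know which one. -/
structure IsState [Fintype C] (s : Fin p → ℕ) (A : Fin p) (own : Fin (k + 1) → C → Fin p) (R : Finset C)
    (t : Fin p → ℕ) (J : Finset (Fin p)) : Prop where
  count : ∀ i P, (Finset.univ.filter fun c => c ∉ R ∧ own i c = P).card + t P = s P
  safe : ∀ c ∉ R, ∃ i j, own i c ≠ own j c
  know : (R = Finset.univ ∧ J = {A}) ∨
    ∀ P ∈ J, ∀ i j, i ≠ j → ∃ c ∉ R, own i c = P ∧ own j c ≠ P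

variable {A : Fin p} {own : Fin (k + 1) → C → Fin p} {R : Finset C} {t : Fin p → ℕ}
  {J : Finset (Fin p)}

/-- An informed player recovers the pattern of the used cards from his own hand. In the initial
state there are no used cards, and `A` is free to choose the secret. -/
theorem IsState.own_eq [Fintype C] (h : IsState s A own R t J) {P : Fin p} (hP : P ∈ J) {i j : Fin (k + 1)}
    (hij : ∀ c ∉ R, own i c = P ↔ own j c = P) : ∀ c ∉ R, own i c = own j c := by
  rcases h.know with ⟨rfl, -⟩ | hk
  · simp
  · by_cases hne : i = j
    · simp [hne]
    · obtain ⟨c, hc, h1, h2⟩ := hk P hP i j hne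
      exact absurd ((hij c hc).1 h1) h2

theorem IsState.card_filter_owner [Fintype C] (h : IsState s A own R t J) {H : Deal s C}
    (hH : H ∈ possible s own R) (P : Fin p) : (R.filter fun c => H.owner c = P).card = t P := by
  obtain ⟨i, hi⟩ := hH
  have h1 := h.count i P
  rw [← H.card_filter_owner P] at h1
  have h2 : (Finset.univ.filter fun c => H.owner c = P) =
      (Finset.univ.filter fun c => c ∉ R ∧ own i c = P) ∪ R.filter fun c => H.owner c = P := by
    ext c
    by_cases hc : c ∈ R
    · simp [hc]
    · simp [hc, hi c hc]
  rw [h2, Finset.card_union_of_disjoint] at h1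
  · omega
  · rw [Finset.disjoint_left]
    intro c hc hc'
    simp at hc hc'
    exact hc.1 hc'.1

/-- The numbers of unused cards after a block of `w` cards of `P` and one card of `Q` has been
used. -/
def take (t : Fin p → ℕ) (P : Fin p) (w : ℕ) (Q : Fin p) (X : Fin p) : ℕ :=
  t X - (if X = P then w else 0) - (if X = Q then 1 else 0)

/-- The position of the foreign card in a block of `w + 1` cards, when `i` is the common secret. -/
def position (w : ℕ) (i : Fin (k + 1)) : Fin (w + 1) := Fin.ofNat (w + 1) i

theorem position_self (i : Fin (k + 1)) : position k i = i := by
  simp [position]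

/-- Positions are secrets modulo `w + 1`. A short block with `1 ≤ w < k` thus still hides the
foreign card, but only a full block reveals the whole secret to its owner. -/
theorem position_surjective {w : ℕ} (hw : w ≤ k) (j : Fin (w + 1)) :
    ∃ i : Fin (k + 1), position w i = j :=
  ⟨⟨j, by omega⟩, by simp [position]⟩

/-- The patterns after the block `e` with owners `P` and `Q` has been used. -/
def extend {w : ℕ} (own : Fin (k + 1) → C → Fin p) (R : Finset C) (e : Fin (w + 1) ↪ C)
    (P Q : Fin p) (i : Fin (k + 1)) (c : C) : Fin p :=
  if c ∈ R then (if c = e (position w i) then Q else P) else own i c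

theorem extend_of_notMem {w : ℕ} (e : Fin (w + 1) ↪ C) (P Q : Fin p) (i : Fin (k + 1)) {c : C}
    (hc : c ∉ R) : extend own R e P Q i c = own i c := if_neg hc

theorem extend_apply {w : ℕ} (e : Fin (w + 1) ↪ C) (he : ∀ j, e j ∈ R) (P Q : Fin p)
    (i : Fin (k + 1)) (j : Fin (w + 1)) :
    extend own R e P Q i (e j) = if j = position w i then Q else P := by
  simp [extend, he]

theorem forall_notMem_sdiff {w : ℕ} {e : Fin (w + 1) ↪ C} {q : C → Prop} :
    (∀ c ∉ R \ Finset.univ.map e, q c) ↔ (∀ c ∉ R, q c) ∧ ∀ j, q (e j) := by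
  constructor
  · intro h
    exact ⟨fun c hc => h c (by simp [hc]), fun j => h _ (by simp)⟩
  · rintro ⟨h1, h2⟩ c hc
    by_cases hR : c ∈ R
    · obtain ⟨j, rfl⟩ : ∃ j, e j = c := by simpa [hR] using hc
      exact h2 j
    · exact h1 c hR

theorem exists_position_ne {w : ℕ} (hw : 1 ≤ w) (j : Fin (w + 1)) : ∃ j', j' ≠ j := by
  have : Nontrivial (Fin (w + 1)) := Fin.nontrivial_iff_two_le.2 (by omega)
  exact exists_ne j

theorem IsState.extend [Fintype C] (h : IsState s A own R t J) {w : ℕ} (e : Fin (w + 1) ↪ C)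
    (he : ∀ j, e j ∈ R) {P Q : Fin p} (hP : P ∈ J) (hQP : Q ≠ P) (hw : 1 ≤ w) (hwk : w ≤ k)
    (hcase : w = k ∨ P ≠ A) (htP : w ≤ t P) (htQ : 0 < t Q) :
    IsState s A (extend own R e P Q) (R \ Finset.univ.map e) (take t P w Q)
      (if w = k then insert Q J else J) where
  count i X := by
    have h1 := h.count i X
    have h2 : (Finset.univ.filter fun c => c ∉ R \ Finset.univ.map e ∧
        SADI.extend own R e P Q i c = X) =
        (Finset.univ.filter fun c => c ∉ R ∧ own i c = X) ∪
        (Finset.univ.filter fun j => (if j = position w i then Q else P) = X).map e := by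
      ext c
      simp only [Finset.mem_filter, Finset.mem_univ, true_and, Finset.mem_union, Finset.mem_map]
      by_cases hR : c ∈ R
      · by_cases hj : ∃ j, e j = c
        · obtain ⟨j, rfl⟩ := hj
          simp [extend_apply e he, hR]
        · have hj' : ∀ j, e j ≠ c := by simpa using hj
          simp [hR, hj']
      · have hj : ∀ j, e j ≠ c := fun j hj => hR (hj ▸ he j)
        simp [hR, hj, extend_of_notMem]
    rw [h2, Finset.card_union_of_disjoint, Finset.card_map]
    · have h3 : (Finset.univ.filter fun j => (if j = position w i then Q else P) = X).card =
          (if X = P then w else 0) + (if X = Q then 1 else 0) := by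
        by_cases hXP : X = P
        · subst hXP
          have : (Finset.univ.filter fun j => (if j = position w i then Q else X) = X) =
              Finset.univ.erase (position w i) := by
            ext j; simp [hQP]
          rw [this, Finset.card_erase_of_mem (Finset.mem_univ _)]
          simp [Ne.symm hQP]
        · by_cases hXQ : X = Q
          · subst hXQ
            have : (Finset.univ.filter fun j => (if j = position w i then X else P) = X) =
                {position w i} := by
              ext j; simp [Ne.symm hXP]
            rw [this]
            simp [hXP]
          · simp only [hXP, hXQ, if_false, add_zero, Finset.card_eq_zero]
            ext j
            by_cases hj : j = position w i <;> simp [hj, Ne.symm hXP, Ne.symm hXQ]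
      rw [h3, take]
      split_ifs with h4 h5 h6
      · exact absurd (h5.symm.trans h4) hQP
      · subst h4; omega
      · subst h6; omega
      · omega
    · rw [Finset.disjoint_left]
      intro c hc hc'
      simp only [Finset.mem_filter, Finset.mem_map] at hc hc'
      obtain ⟨j, -, rfl⟩ := hc'
      exact hc.2.1 (he j)
  safe := by
    rw [forall_notMem_sdiff]
    constructor
    · intro c hc
      simpa [extend_of_notMem _ _ _ _ hc] using h.safe c hc
    · intro j
      obtain ⟨j', hj'⟩ := exists_position_ne hw j
      obtain ⟨i, hi⟩ := position_surjective hwk j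
      obtain ⟨i', hi'⟩ := position_surjective hwk j'
      refine ⟨i, i', ?_⟩
      simp [extend_apply e he, hi, hi', Ne.symm hj', hQP]
  know := by
    right
    have hmem : ∀ j, e j ∉ R \ Finset.univ.map e := by simp
    have hold : ∀ X, (∀ i j, i ≠ j → ∃ c ∉ R, own i c = X ∧ own j c ≠ X) → ∀ i j, i ≠ j →
        ∃ c ∉ R \ Finset.univ.map e, SADI.extend own R e P Q i c = X ∧
          SADI.extend own R e P Q j c ≠ X := by
      intro X hX i j hij
      obtain ⟨c, hc, h'⟩ := hX i j hij
      exact ⟨c, by simp [hc], by simpa [extend_of_notMem _ _ _ _ hc] using h'⟩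
    have hnewP : w = k → ∀ i j, i ≠ j → ∃ c ∉ R \ Finset.univ.map e,
        SADI.extend own R e P Q i c = P ∧ SADI.extend own R e P Q j c ≠ P := by
      rintro rfl i j hij
      refine ⟨e j, hmem j, ?_⟩
      simp [extend_apply e he, position_self, Ne.symm hij, hQP]
    have hnewQ : w = k → ∀ i j, i ≠ j → ∃ c ∉ R \ Finset.univ.map e,
        SADI.extend own R e P Q i c = Q ∧ SADI.extend own R e P Q j c ≠ Q := by
      rintro rfl i j hij
      refine ⟨e i, hmem i, ?_⟩
      simp [extend_apply e he, position_self, hij, Ne.symm hQP]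
    intro X hX
    -- In the initial state `hcase` forces a full block, since only a full block fixes the secret.
    rcases h.know with ⟨-, rfl⟩ | hk
    · obtain rfl : P = A := by simpa using hP
      have hwk' : w = k := by simpa using hcase
      rw [if_pos hwk'] at hX
      rcases (by simpa using hX : X = Q ∨ X = P) with rfl | rfl
      · exact hnewQ hwk'
      · exact hnewP hwk'
    · split_ifs at hX with hwk'
      · rcases Finset.mem_insert.1 hX with rfl | hX
        · exact hnewQ hwk'
        · exact hold X (hk X hX)
      · exact hold X (hk X hX)

/-- A block of a given size, all of whose cards but the one in a given position belong to `W`. -/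
theorem exists_block {w : ℕ} {W : Finset C} (hW : w ≤ W.card) {y : C} (hy : y ∉ W)
    (x : Fin (w + 1)) : ∃ e : Fin (w + 1) ↪ C, e x = y ∧ ∀ j ≠ x, e j ∈ W := by
  obtain ⟨V, hVW, hV⟩ := Finset.exists_subset_card_eq hW
  have hyV : y ∉ V := fun h => hy (hVW h)
  have hcard : (insert y V).card = w + 1 := by rw [Finset.card_insert_of_notMem hyV, hV]
  let f := (Finset.equivFinOfCardEq hcard).symm
  let y' : ↥(insert y V) := ⟨y, Finset.mem_insert_self _ _⟩
  let g : Fin (w + 1) ≃ ↥(insert y V) := (Equiv.swap x (f.symm y')).trans f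
  have hg : g x = y' := by simp [g]
  refine ⟨g.toEmbedding.trans (Function.Embedding.subtype _), ?_, fun j hj => ?_⟩
  · simp [hg, y']
  · have hne : g j ≠ y' := fun h => hj (g.injective (h.trans hg.symm))
    have hmem := (g j).2
    rcases Finset.mem_insert.1 hmem with h | h
    · exact absurd (Subtype.ext h) hne
    · exact hVW h

/-- The player `P`, who knows the common secret, announces a block with `w` of his unused cards and
one foreign card, and the owner `Q` of that card reports. -/
theorem Win.step [Fintype C] (h : IsState s A own R t J) {P : Fin p} (hP : P ∈ J) {w : ℕ} (hw : 1 ≤ w)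
    (hwk : w ≤ k) (hcase : w = k ∨ P ≠ A) (htP : w ≤ t P) (hQ : ∃ Q ≠ P, 0 < t Q)
    (hwin : ∀ Q ≠ P, 0 < t Q → ∀ (own' : Fin (k + 1) → C → Fin p) (R' : Finset C),
      IsState s A own' R' (take t P w Q) (if w = k then insert Q J else J) →
      Win (possible s own' R')) : Win (possible s own R) := by
  -- The hands of `P` that agree with some pattern `i` on the used cards and miss exactly position
  -- `i` of the block.
  let S (e : Fin (w + 1) ↪ C) : Set (Finset C) := {x | ∃ i, (∀ c ∉ R, c ∈ x ↔ own i c = P) ∧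
    ∀ j, e j ∈ x ↔ j ≠ position w i}
  refine Win.announce P {x | ∃ e, (∀ j, e j ∈ R) ∧ x = S e} ?_ ?_
  · intro H hH
    have hcard := h.card_filter_owner hH
    obtain ⟨i, hi⟩ := hH
    obtain ⟨Q, hQP, hQ⟩ := hQ
    rw [← hcard Q, Finset.card_pos] at hQ
    obtain ⟨y, hy⟩ := hQ
    rw [Finset.mem_filter] at hy
    obtain ⟨e, he, he'⟩ := exists_block (W := R.filter fun c => H.owner c = P) (y := y)
      (htP.trans (hcard P).ge) (by simp [hy, hQP]) (position w i)
    refine ⟨_, ⟨e, fun j => ?_, rfl⟩, i, fun c hc => ?_, fun j => ?_⟩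
    · by_cases hj : j = position w i
      · rw [hj, he]; exact hy.1
      · exact (Finset.mem_filter.1 (he' j hj)).1
    · rw [Deal.mem_hand_iff, hi c hc]
    · rw [Deal.mem_hand_iff]
      by_cases hj : j = position w i
      · simp [hj, he, hy.2, hQP]
      · simp [hj, (Finset.mem_filter.1 (he' j hj)).2]
  · rintro _ ⟨e, he, rfl⟩
    -- Everyone says whether he holds a card of the block; only `P` and `Q` say yes, which makes `Q`
    -- public.
    refine Win.claims (fun _ x => ∃ j, e j ∈ x) ?_
    rintro H ⟨hH, hHS⟩
    obtain ⟨i, hi, hie⟩ := hHS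
    simp only [Deal.mem_hand_iff] at hi hie
    have hcard := h.card_filter_owner hH
    obtain ⟨Q, hQdef⟩ : ∃ Q, H.owner (e (position w i)) = Q := ⟨_, rfl⟩
    have hQP : Q ≠ P := fun hQP => (hie (position w i)).1 (hQdef.trans hQP) rfl
    have hQpos : 0 < t Q := by
      rw [← hcard Q, Finset.card_pos]
      exact ⟨_, Finset.mem_filter.2 ⟨he _, hQdef⟩⟩
    have hclaim : ∀ (H' : Deal s C) (i' : Fin (k + 1)),
        (∀ j, H'.owner (e j) = P ↔ j ≠ position w i') → ∀ X, (∃ j, e j ∈ H'.hand X) ↔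
        X = P ∨ X = H'.owner (e (position w i')) := by
      intro H' i' h' X
      simp only [Deal.mem_hand_iff]
      constructor
      · rintro ⟨j, rfl⟩
        by_cases hj : j = position w i'
        · right; rw [hj]
        · left; exact (h' j).2 hj
      · rintro (rfl | rfl)
        · obtain ⟨j, hj⟩ := exists_position_ne hw (position w i')
          exact ⟨j, (h' j).2 hj⟩
        · exact ⟨_, rfl⟩
    convert hwin Q hQP hQpos _ _ (h.extend e he hP hQP hw hwk hcase htP hQpos) using 1
    ext H'
    constructor
    · rintro ⟨⟨⟨i₁, hi₁⟩, i₂, hi₂, hie₂⟩, hcl⟩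
      simp only [Deal.mem_hand_iff] at hi₂ hie₂
      refine ⟨i₂, ?_⟩
      rw [forall_notMem_sdiff]
      refine ⟨fun c hc => ?_, fun j => ?_⟩
      -- The secrets `i₁` from the old patterns and `i₂` from the announcement both match the hand
      -- of `P`, so their patterns agree on the used cards.
      · rw [extend_of_notMem _ _ _ _ hc, hi₁ c hc]
        refine h.own_eq hP (fun d hd => ?_) c hc
        rw [← hi₂ d hd, hi₁ d hd]
      · rw [extend_apply e he]
        split_ifs with hj
        · have h1 := (hclaim H' i₂ hie₂ (H'.owner (e j))).2 (Or.inr (by rw [hj]))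
          rw [hcl, hclaim H i hie, hQdef] at h1
          exact h1.resolve_left fun h2 => (hie₂ j).1 h2 hj
        · exact (hie₂ j).2 hj
    · rintro ⟨i', hi'⟩
      rw [forall_notMem_sdiff] at hi'
      obtain ⟨h1, h2⟩ := hi'
      have h1' : ∀ c ∉ R, H'.owner c = own i' c := fun c hc => by
        rw [h1 c hc, extend_of_notMem _ _ _ _ hc]
      have h2' : ∀ j, H'.owner (e j) = if j = position w i' then Q else P := fun j => by
        rw [h2 j, extend_apply e he]
      have h3 : ∀ j, H'.owner (e j) = P ↔ j ≠ position w i' := fun j => by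
        rw [h2']
        by_cases hj : j = position w i' <;> simp [hj, hQP]
      refine ⟨⟨⟨i', h1'⟩, i', fun c hc => ?_, fun j => ?_⟩, fun X => ?_⟩
      · rw [Deal.mem_hand_iff, h1' c hc]
      · rw [Deal.mem_hand_iff, h3]
      · rw [hclaim H' i' h3, hclaim H i hie, hQdef, h2', if_pos rfl]

/-! ### Settling all unused cards at once -/

/-- A finite set can be covered by `k` of its subsets with `m` elements each. -/
theorem exists_cover (S : Finset C) {m : ℕ} (hm : m ≤ S.card) (hS : S.card ≤ k * m) :
    ∃ X : Fin k → Finset C, (∀ j, X j ⊆ S ∧ (X j).card = m) ∧ ∀ x ∈ S, ∃ j, x ∈ X j := by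
  -- Enumerate `S`, cut it into slices of length `m`, and pad every slice to exactly `m` elements.
  have hex : ∀ j : Fin k, ∃ X : Finset C, (S.filter fun x => ∃ hx : x ∈ S,
      ((S.equivFin ⟨x, hx⟩ : ℕ)) / m = j) ⊆ X ∧ X ⊆ S ∧ X.card = m := by
    intro j
    refine Finset.exists_subsuperset_card_eq (Finset.filter_subset _ _) ?_ hm
    · have hcard : (Finset.Ico (j * m : ℕ) (j * m + m)).card = m := by simp
      conv_rhs => rw [← hcard]
      refine Finset.card_le_card_of_injOn
        (fun x => if hx : x ∈ S then (S.equivFin ⟨x, hx⟩ : ℕ) else 0) ?_ ?_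
      · intro x hx
        obtain ⟨hxS, hx, hj⟩ := Finset.mem_filter.1 hx
        simp only [hxS, dif_pos]
        have hpos : 0 < m := by
          rcases Nat.eq_zero_or_pos m with rfl | h
          · have := Finset.card_pos.2 ⟨x, hxS⟩
            omega
          · exact h
        rw [Finset.coe_Ico, Set.mem_Ico, ← hj, mul_comm]
        exact ⟨Nat.mul_div_le _ _, by
          simpa [Nat.mul_succ] using Nat.lt_mul_div_succ (S.equivFin ⟨x, hxS⟩ : ℕ) hpos⟩
      · intro x hx y hy hxy
        have hxS := (Finset.mem_filter.1 hx).1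
        have hyS := (Finset.mem_filter.1 hy).1
        simp only [hxS, hyS, dif_pos] at hxy
        have := S.equivFin.injective (Fin.ext hxy)
        simpa using this
  choose X h1 h2 h3 using hex
  refine ⟨X, fun j => ⟨h2 j, h3 j⟩, fun x hx => ?_⟩
  have hlt : (S.equivFin ⟨x, hx⟩ : ℕ) / m < k := by
    have := (S.equivFin ⟨x, hx⟩).2
    refine Nat.div_lt_of_lt_mul ?_
    rw [mul_comm]
    omega
  exact ⟨⟨_, hlt⟩, h1 _ (Finset.mem_filter.2 ⟨hx, hx, rfl⟩)⟩

/-- A permutation that maps one subset of `R` onto another one of the same size and fixes the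
complement of `R`. -/
theorem exists_perm {U V : Finset C} (hU : U ⊆ R) (hV : V ⊆ R) (h : U.card = V.card) :
    ∃ g : Equiv.Perm C, (∀ c, g c ∈ R ↔ c ∈ R) ∧ ∀ c, g c ∈ V ↔ c ∈ U := by
  have hcard : ∀ W : Finset C, W ⊆ R → Fintype.card {x : R // (x : C) ∈ W} = W.card := by
    intro W hW
    rw [Fintype.card_subtype]
    refine Finset.card_bij (fun x _ => (x : C)) (by simp) (fun x _ y _ h => Subtype.ext h) ?_
    intro c hc
    exact ⟨⟨c, hW hc⟩, by simpa using hc, rfl⟩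
  let f : {x : R // (x : C) ∈ U} ≃ {x : R // (x : C) ∈ V} :=
    Fintype.equivOfCardEq (by rw [hcard U hU, hcard V hV, h])
  refine ⟨Equiv.Perm.ofSubtype f.extendSubtype, fun c => ?_, fun c => ?_⟩
  · exact Equiv.Perm.ofSubtype_apply_mem_iff_mem _ c
  · by_cases hc : c ∈ R
    · rw [Equiv.Perm.ofSubtype_apply_of_mem _ hc]
      by_cases hcU : c ∈ U
      · exact iff_of_true (f.extendSubtype_mem ⟨c, hc⟩ hcU) hcU
      · exact iff_of_false (f.extendSubtype_not_mem ⟨c, hc⟩ hcU) hcU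
    · rw [Equiv.Perm.ofSubtype_apply_of_not_mem _ hc]
      exact iff_of_false (fun h => hc (hV h)) fun h => hc (hU h)

/-- Subsets of `R` of the size of `U`, one of which is `U`, with union `R` and empty
intersection. -/
theorem exists_family {U : Finset C} (hU : U ⊆ R) (h1 : U.card ≤ k * (R \ U).card)
    (h2 : (R \ U).card ≤ k * U.card) (i₀ : Fin (k + 1)) :
    ∃ V : Fin (k + 1) → Finset C, V i₀ = U ∧ (∀ i, V i ⊆ R ∧ (V i).card = U.card) ∧
      ∀ c ∈ R, (∃ i, c ∈ V i) ∧ ∃ i, c ∉ V i := by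
  have hk : U.card ≤ k * U.card ∧ (R \ U).card ≤ k * (R \ U).card := by
    rcases Nat.eq_zero_or_pos k with rfl | hk
    · simp only [zero_mul] at h1 h2 ⊢
      exact ⟨h1, h2⟩
    · exact ⟨Nat.le_mul_of_pos_left _ hk, Nat.le_mul_of_pos_left _ hk⟩
  obtain ⟨X, hX, hXU⟩ := exists_cover (k := k) U (m := min U.card (R \ U).card)
    (min_le_left _ _) (by rcases min_choice U.card (R \ U).card with h | h <;> rw [h]; exacts [hk.1, h1])
  obtain ⟨Y, hY, hYU⟩ := exists_cover (k := k) (R \ U) (m := min U.card (R \ U).card)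
    (min_le_right _ _) (by rcases min_choice U.card (R \ U).card with h | h <;> rw [h]; exacts [h2, hk.2])
  -- Each decoy exchanges a part `X j` of `U` for an equally large part `Y j` of the complement. As
  -- the `X j` cover `U` and the `Y j` cover the complement, each card changes sides at least once.
  refine ⟨i₀.insertNth U fun j => U \ X j ∪ Y j, by simp, ?_, ?_⟩
  · intro i
    induction i using Fin.succAboveCases i₀ with
    | x => simpa using hU
    | p j =>
      simp only [Fin.insertNth_apply_succAbove]
      constructor
      · exact Finset.union_subset (Finset.sdiff_subset.trans hU)
          ((hY j).1.trans Finset.sdiff_subset)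
      · rw [Finset.card_union_of_disjoint, Finset.card_sdiff_of_subset (hX j).1, (hX j).2,
          (hY j).2]
        · have := min_le_left U.card (R \ U).card
          omega
        · exact Finset.disjoint_of_subset_left Finset.sdiff_subset
            (Finset.disjoint_of_subset_right (hY j).1 Finset.disjoint_sdiff)
  · intro c hc
    by_cases hcU : c ∈ U
    · obtain ⟨j, hj⟩ := hXU c hcU
      refine ⟨⟨i₀, by simpa using hcU⟩, ⟨i₀.succAbove j, ?_⟩⟩
      have : c ∉ Y j := fun h => (Finset.mem_sdiff.1 ((hY j).1 h)).2 hcU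
      simp [hj, this]
    · obtain ⟨j, hj⟩ := hYU c (Finset.mem_sdiff.2 ⟨hc, hcU⟩)
      exact ⟨⟨i₀.succAbove j, by simp [hj]⟩, ⟨i₀, by simpa using hcU⟩⟩

/-- If all players know the common secret and `A` holds neither too many nor too few of the unused
cards, then these can be used all at once. -/
theorem Win.of_forall_know [Fintype C] (h : IsState s A own R t J) (hJ : J = Finset.univ)
    (hp : 2 ≤ p) (h1 : t A ≤ k * ∑ P ∈ Finset.univ.erase A, t P)
    (h2 : ∑ P ∈ Finset.univ.erase A, t P ≤ k * t A) : Win (possible s own R) := by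
  have hknow : ∀ P : Fin p, ∀ i j, (∀ c ∉ R, own i c = P ↔ own j c = P) → i = j := by
    rcases h.know with ⟨-, hA⟩ | hk
    · exfalso
      have : Nontrivial (Fin p) := Fin.nontrivial_iff_two_le.2 hp
      obtain ⟨B, hB⟩ := exists_ne A
      have := Finset.mem_univ B
      rw [← hJ, hA, Finset.mem_singleton] at this
      exact hB this
    · intro P i j hij
      by_contra hne
      obtain ⟨c, hc, h3, h4⟩ := hk P (by simp [hJ]) i j hne
      exact h4 ((hij c hc).1 h3)
  let S (τ : Fin (k + 1) → Equiv.Perm C) (U : Finset C) : Set (Finset C) :=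
    {x | ∃ i, (∀ c ∉ R, c ∈ x ↔ own i c = A) ∧ ∀ c ∈ R, τ i c ∈ x ↔ c ∈ U}
  refine Win.announce A {x | ∃ τ U, (∀ i c, τ i c ∈ R ↔ c ∈ R) ∧
    (∀ c ∈ R, (∃ i, (τ i).symm c ∈ U) ∧ ∃ i, (τ i).symm c ∉ U) ∧ x = S τ U} ?_ ?_
  · intro H hH
    have hcard := h.card_filter_owner hH
    obtain ⟨i₀, hi₀⟩ := hH
    set U := R.filter fun c => H.owner c = A with hUdef
    have hUR : U ⊆ R := Finset.filter_subset _ _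
    have hUc : U.card = t A := hcard A
    have hRU : (R \ U).card = ∑ P ∈ Finset.univ.erase A, t P := by
      have hR : R.card = ∑ P, t P := by
        rw [Finset.card_eq_sum_card_fiberwise (f := H.owner) (t := Finset.univ) (by simp)]
        exact Finset.sum_congr rfl fun P _ => hcard P
      rw [Finset.card_sdiff_of_subset hUR, hR, hUc,
        ← Finset.add_sum_erase Finset.univ t (Finset.mem_univ A)]
      omega
    -- The true hand sits at the actual secret `i₀`; the other sets are decoys.
    obtain ⟨V, hV0, hV, hVR⟩ := exists_family hUR (k := k) (by rw [hRU, hUc]; exact h1)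
      (by rw [hRU, hUc]; exact h2) i₀
    choose τ hτR hτV using fun i => exists_perm hUR (hV i).1 (hV i).2.symm
    refine ⟨_, ⟨τ, U, hτR, fun c hc => ?_, rfl⟩, i₀, fun c hc => ?_, fun c hc => ?_⟩
    · obtain ⟨⟨i, hi⟩, j, hj⟩ := hVR c hc
      refine ⟨⟨i, ?_⟩, j, ?_⟩
      · rw [← hτV i, Equiv.apply_symm_apply]; exact hi
      · rw [← hτV j, Equiv.apply_symm_apply]; exact hj
    · rw [Deal.mem_hand_iff, hi₀ c hc]
    · rw [Deal.mem_hand_iff, ← hτV i₀ c, hV0, hUdef, Finset.mem_filter, hτR]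
      simp [hc]
  · rintro _ ⟨τ, U, hτR, hU, rfl⟩
    -- Every player publishes the preimage of his unused cards under `τ i`, where he reads `i` off
    -- his own hand.
    refine Win.claims (fun P x => {c | c ∈ R ∧ ∃ i, (∀ d ∉ R, d ∈ x ↔ own i d = P) ∧
      τ i c ∈ x}) fun H hH => ?_
    have hclaim : ∀ (H' : Deal s C) (i : Fin (k + 1)), (∀ c ∉ R, H'.owner c = own i c) →
        ∀ P, {c | c ∈ R ∧ ∃ i, (∀ d ∉ R, d ∈ H'.hand P ↔ own i d = P) ∧ τ i c ∈ H'.hand P} =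
          {c | c ∈ R ∧ H'.owner (τ i c) = P} := by
      intro H' i hi P
      ext c
      simp only [Set.mem_ofPred_eq, Deal.mem_hand_iff]
      refine and_congr_right fun _ => ⟨?_, fun hc => ⟨i, fun d hd => by rw [hi d hd], hc⟩⟩
      rintro ⟨j, hj, hc⟩
      obtain rfl : i = j := hknow P i j fun d hd => by rw [← hj d hd, hi d hd]
      exact hc
    -- Replacing the secret `i` by `j` transports the deal by `τ j ∘ (τ i)⁻¹`. Hand sizes are
    -- preserved because all patterns use up equally many cards of each player.
    have hshift : ∀ (H' : Deal s C) (i j : Fin (k + 1)), (∀ c ∉ R, H'.owner c = own i c) →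
        ∃ H'' : Deal s C, (∀ c ∉ R, H''.owner c = own j c) ∧
          ∀ c ∈ R, H''.owner c = H'.owner (τ i ((τ j).symm c)) := by
      intro H' i j hi
      have hτ : ∀ c, (τ j).symm c ∈ R ↔ c ∈ R := fun c => by rw [← hτR j]; simp
      refine ⟨Deal.ofOwner (fun c => if c ∈ R then H'.owner (τ i ((τ j).symm c)) else own j c)
        fun P => ?_, fun c hc => ?_, fun c hc => ?_⟩
      · have hmap : (R.filter fun c => H'.owner (τ i ((τ j).symm c)) = P).card =
            (R.filter fun c => H'.owner c = P).card := by
          refine Finset.card_bij (fun c _ => τ i ((τ j).symm c)) (fun c hc => ?_)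
            (fun c _ d _ h => by simpa using h) fun c hc => ⟨τ j ((τ i).symm c), ?_, by simp⟩
          · simpa [hτR, hτ] using hc
          · have hc' : (τ i).symm c ∈ R ↔ c ∈ R := by rw [← hτR i]; simp
            simpa [hτR, hc'] using hc
        rw [← h.count j P, ← h.card_filter_owner ⟨i, hi⟩ P, ← hmap,
          ← Finset.card_union_of_disjoint]
        · congr 1
          ext c
          by_cases hc : c ∈ R <;> simp [hc]
        · rw [Finset.disjoint_left]
          intro c hc hc'
          exact (Finset.mem_filter.1 hc).2.1 (Finset.mem_filter.1 hc').1
      · rw [Deal.owner_ofOwner, if_neg hc]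
      · rw [Deal.owner_ofOwner, if_pos hc]
    obtain ⟨⟨i, hi⟩, -⟩ := hH
    refine Win.final ?_ ?_
    · rintro H₁ ⟨⟨⟨i₁, hi₁⟩, -⟩, hc₁⟩ H₂ ⟨⟨⟨i₂, hi₂⟩, -⟩, hc₂⟩ P hP
      obtain rfl : i₁ = i₂ := hknow P i₁ i₂ fun c hc => by
        rw [← hi₁ c hc, ← hi₂ c hc, ← Deal.mem_hand_iff, hP, Deal.mem_hand_iff]
      refine Deal.ext_owner fun c => ?_
      by_cases hc : c ∈ R
      · have hc' : (τ i₁).symm c ∈ R := by rw [← hτR i₁]; simpa using hc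
        have h3 := (hc₁ (H₁.owner c)).trans (hc₂ (H₁.owner c)).symm
        simp only [hclaim _ _ hi₁, hclaim _ _ hi₂] at h3
        have h4 := (Set.ext_iff.1 h3 ((τ i₁).symm c)).1 (by simp [hc'])
        simpa using h4.2.symm
      · rw [hi₁ c hc, hi₂ c hc]
    · rintro H₁ ⟨⟨⟨i₁, hi₁⟩, hS⟩, hc₁⟩
      have hmem : ∀ (H₂ : Deal s C) (j : Fin (k + 1)), (∀ c ∉ R, H₂.owner c = own j c) →
          (∀ c ∈ R, H₂.owner c = H₁.owner (τ i₁ ((τ j).symm c))) →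
          H₂ ∈ {H' ∈ possible s own R ∩ handIn A (S τ U) | ∀ P,
            {c | c ∈ R ∧ ∃ i, (∀ d ∉ R, d ∈ H'.hand P ↔ own i d = P) ∧ τ i c ∈ H'.hand P} =
            {c | c ∈ R ∧ ∃ i, (∀ d ∉ R, d ∈ H.hand P ↔ own i d = P) ∧ τ i c ∈ H.hand P}} := by
        intro H₂ j hj hjR
        have hR : ∀ c ∈ R, H₂.owner (τ j c) = H₁.owner (τ i₁ c) := fun c hc => by
          rw [hjR _ ((hτR j c).2 hc), Equiv.symm_apply_apply]
        refine ⟨⟨⟨j, hj⟩, j, fun c hc => ?_, fun c hc => ?_⟩, fun P => ?_⟩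
        · rw [Deal.mem_hand_iff, hj c hc]
        · obtain ⟨i', hi', hU'⟩ := hS
          obtain rfl : i₁ = i' := hknow A _ _ fun d hd => by
            rw [← hi' d hd, Deal.mem_hand_iff, hi₁ d hd]
          rw [Deal.mem_hand_iff, hR c hc, ← Deal.mem_hand_iff]
          exact hU' c hc
        · rw [← hc₁ P]
          simp only [hclaim _ _ hi₁, hclaim _ _ hj]
          ext c
          simp only [Set.mem_ofPred_eq]
          exact and_congr_right fun hc => by rw [hR c hc]
      intro c P _
      -- Two candidate deals with different owners of `c` suffice, since at least one of them does
      -- not give `c` to `P`.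
      have hne : ∃ H₂ H₃ : Deal s C, (∃ j, (∀ c ∉ R, H₂.owner c = own j c) ∧
          ∀ c ∈ R, H₂.owner c = H₁.owner (τ i₁ ((τ j).symm c))) ∧
          (∃ j, (∀ c ∉ R, H₃.owner c = own j c) ∧
          ∀ c ∈ R, H₃.owner c = H₁.owner (τ i₁ ((τ j).symm c))) ∧ H₂.owner c ≠ H₃.owner c := by
        have hpair : ∃ i j, ∀ H₂ H₃ : Deal s C, (∀ c ∉ R, H₂.owner c = own i c) →
            (∀ c ∈ R, H₂.owner c = H₁.owner (τ i₁ ((τ i).symm c))) →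
            (∀ c ∉ R, H₃.owner c = own j c) →
            (∀ c ∈ R, H₃.owner c = H₁.owner (τ i₁ ((τ j).symm c))) →
            H₂.owner c ≠ H₃.owner c := by
          by_cases hc : c ∈ R
          · obtain ⟨i', hi', hU'⟩ := hS
            obtain rfl : i₁ = i' := hknow A _ _ fun d hd => by
              rw [← hi' d hd, Deal.mem_hand_iff, hi₁ d hd]
            have hmR : ∀ j, (τ j).symm c ∈ R := fun j => by rw [← hτR j]; simpa using hc
            obtain ⟨⟨i, hi⟩, j, hj⟩ := hU c hc
            refine ⟨i, j, fun H₂ H₃ _ h₂ _ h₃ heq => ?_⟩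
            rw [h₂ c hc, h₃ c hc] at heq
            rw [← hU' _ (hmR i), Deal.mem_hand_iff] at hi
            rw [← hU' _ (hmR j), Deal.mem_hand_iff, ← heq] at hj
            exact hj hi
          · obtain ⟨i, j, hij⟩ := h.safe c hc
            exact ⟨i, j, fun H₂ H₃ h₂ _ h₃ _ => by rwa [h₂ c hc, h₃ c hc]⟩
        obtain ⟨i, j, hij⟩ := hpair
        obtain ⟨H₂, h₂, h₂'⟩ := hshift H₁ i₁ i hi₁
        obtain ⟨H₃, h₃, h₃'⟩ := hshift H₁ i₁ j hi₁
        exact ⟨H₂, H₃, ⟨i, h₂, h₂'⟩, ⟨j, h₃, h₃'⟩, hij H₂ H₃ h₂ h₂' h₃ h₃'⟩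
      obtain ⟨H₂, H₃, ⟨i, h₂, h₂'⟩, ⟨j, h₃, h₃'⟩, hne⟩ := hne
      by_cases hP : H₂.owner c = P
      · exact ⟨H₃, hmem H₃ j h₃ h₃', by rw [Deal.mem_hand_iff, ← hP]; exact hne.symm⟩
      · exact ⟨H₂, hmem H₂ i h₂ h₂', by rwa [Deal.mem_hand_iff]⟩

/-! ### Reduction to a game on hand sizes -/

/-- The game on the numbers of unused cards in which the answers to the announcements of blocks are
chosen by an adversary. -/
inductive Playable (k : ℕ) (A : Fin p) : (Fin p → ℕ) → Finset (Fin p) → Prop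
  | final (t : Fin p → ℕ) (h1 : t A ≤ k * ∑ P ∈ Finset.univ.erase A, t P)
      (h2 : ∑ P ∈ Finset.univ.erase A, t P ≤ k * t A) : Playable k A t Finset.univ
  | step (t : Fin p → ℕ) (J : Finset (Fin p)) (P : Fin p) (hP : P ∈ J) (w : ℕ) (hw : 1 ≤ w)
      (hwk : w ≤ k) (hcase : w = k ∨ P ≠ A) (htP : w ≤ t P) (hQ : ∃ Q ≠ P, 0 < t Q)
      (h : ∀ Q ≠ P, 0 < t Q → Playable k A (take t P w Q) (if w = k then insert Q J else J)) :
      Playable k A t J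

theorem Playable.win [Fintype C] (hp : 2 ≤ p) (ht : Playable k A t J) (h : IsState s A own R t J) :
    Win (possible s own R) := by
  induction ht generalizing own R with
  | final t h1 h2 => exact Win.of_forall_know h rfl hp h1 h2
  | step t J P hP w hw hwk hcase htP hQ _ ih =>
    exact Win.step h hP hw hwk hcase htP hQ fun Q hQP hQ0 _ _ h' => ih Q hQP hQ0 h'

theorem Playable.solvable (hp : 2 ≤ p) (h : Playable k A s {A}) : Solvable s := by
  refine Solvable.of_win (by omega) ?_
  have hst : IsState s A (fun (_ : Fin (k + 1)) (_ : Fin (∑ P, s P)) => A) Finset.univ s {A} :=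
    ⟨by simp, by simp, Or.inl ⟨rfl, rfl⟩⟩
  convert h.win hp hst
  exact (Set.eq_univ_of_forall fun H => show H ∈ possible s _ _ from ⟨0, by simp⟩).symm

end

end SADI

/-! ### Winning the game on hand sizes -/

namespace SADI

section
variable {p : ℕ} {A : Fin p} {t : Fin p → ℕ} {J : Finset (Fin p)}

/-- The number of unused cards of the players other than `A`. -/
def rest (A : Fin p) (t : Fin p → ℕ) : ℕ := ∑ P ∈ Finset.univ.erase A, t P

/-- The number of players other than `A` who still have unused cards. -/
def active (A : Fin p) (t : Fin p → ℕ) : ℕ :=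
  ((Finset.univ.erase A).filter fun P => 0 < t P).card

theorem le_rest {X : Fin p} (hX : X ≠ A) : t X ≤ rest A t :=
  Finset.single_le_sum (f := t) (fun _ _ => Nat.zero_le _) (by simp [hX])

theorem take_add {P Q : Fin p} {w : ℕ} (hQP : Q ≠ P) (hP : w ≤ t P) (hQ : 0 < t Q) (X : Fin p) :
    take t P w Q X + (if X = P then w else 0) + (if X = Q then 1 else 0) = t X := by
  rw [take]
  split_ifs with h1 h2 h2
  · exact absurd (h2.symm.trans h1) hQP
  · subst h1; omega
  · subst h2; omega
  · omega

theorem rest_take_add {P Q : Fin p} {w : ℕ} (hQP : Q ≠ P) (hP : w ≤ t P) (hQ : 0 < t Q) :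
    rest A (take t P w Q) + (if P ≠ A then w else 0) + (if Q ≠ A then 1 else 0) = rest A t := by
  have h : rest A t = ∑ X ∈ Finset.univ.erase A,
      (take t P w Q X + (if X = P then w else 0) + (if X = Q then 1 else 0)) :=
    Finset.sum_congr rfl fun X _ => (take_add hQP hP hQ X).symm
  rw [h, Finset.sum_add_distrib, Finset.sum_add_distrib, Finset.sum_ite_eq', Finset.sum_ite_eq']
  simp [rest]

theorem active_take_le {P Q : Fin p} {w : ℕ} : active A (take t P w Q) ≤ active A t := by
  refine Finset.card_le_card fun X hX => ?_
  rw [Finset.mem_filter] at hX ⊢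
  refine ⟨hX.1, lt_of_lt_of_le hX.2 ?_⟩
  rw [take]
  omega

theorem active_take_lt {P Q : Fin p} (hP : P ≠ A) (htP : 0 < t P) :
    active A (take t P (t P) Q) < active A t := by
  refine Finset.card_lt_card ((Finset.ssubset_iff_of_subset fun X hX => ?_).2 ⟨P, ?_, ?_⟩)
  · rw [Finset.mem_filter] at hX ⊢
    refine ⟨hX.1, lt_of_lt_of_le hX.2 ?_⟩
    rw [take]
    omega
  · simp [hP, htP]
  · simp [take]

theorem active_le : active A t ≤ p := by
  simpa [active] using Finset.card_le_univ ((Finset.univ.erase A).filter fun P => 0 < t P)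

theorem exists_outsider (hA : A ∈ J) (hJ : J ≠ Finset.univ) : ∃ X ∉ J, X ≠ A := by
  obtain ⟨X, hX⟩ : ∃ X, X ∉ J := by
    by_contra! h
    exact hJ (Finset.eq_univ_of_forall h)
  exact ⟨X, hX, fun h => hX (h ▸ hA)⟩

theorem take_of_notMem {P Q X : Fin p} {w : ℕ} (hP : P ∈ J) (hX : X ∉ insert Q J) :
    take t P w Q X = t X := by
  rw [Finset.mem_insert, not_or] at hX
  have h : X ≠ P := fun h => hX.2 (h ▸ hP)
  simp [take, h, hX.1]

/-- The case in which `A` holds so many cards that all blocks can be announced by `A`. -/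
theorem Playable.of_majority {k u r : ℕ} (hk : 1 ≤ k) (hku : 2 * r + k ≤ k * u) (hA : A ∈ J)
    (h1 : t A ≤ k * rest A t) (h2 : k * rest A t ≤ t A + r) (h3 : rest A t ≤ r)
    (h4 : u ≤ rest A t + 1) (h5 : ∀ X ∉ J, u ≤ t X) : Playable k A t J := by
  induction hn : rest A t using Nat.strong_induction_on generalizing t J with
  | h n ih =>
  subst hn
  -- The invariant `u ≤ rest A t + 1` allows for the card spent in the step that informs the last
  -- outsider. It keeps the hand of `A` at least as large as the rest at the end.
  have hk3 : k * u ≤ k * rest A t + k := by nlinarith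
  by_cases hJ : J = Finset.univ
  · subst hJ
    refine Playable.final t h1 ?_
    have : t A ≤ k * t A := Nat.le_mul_of_pos_left _ hk
    change rest A t ≤ _
    omega
  · obtain ⟨X, hXJ, hXA⟩ := exists_outsider hA hJ
    have hX := h5 X hXJ
    have hXr : t X ≤ rest A t := le_rest hXA
    have hur : k * u ≤ k * rest A t := Nat.mul_le_mul_left k (hX.trans hXr)
    have hkA : k ≤ t A := by omega
    have hu : 0 < u := by
      rcases Nat.eq_zero_or_pos u with rfl | h
      · omega
      · exact h
    refine Playable.step t J A hA k hk le_rfl (Or.inl rfl) hkA ⟨X, hXA, hu.trans_le hX⟩ ?_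
    intro Q hQA hQ
    rw [if_pos rfl]
    have e1 := take_add hQA hkA hQ A
    have e2 := rest_take_add (A := A) hQA hkA hQ
    simp only [if_true, if_neg hQA.symm, ne_eq, not_true_eq_false, if_false, hQA,
      not_false_eq_true, add_zero] at e1 e2
    -- Both `k * rest` and the hand of `A` drop by `k`, so their difference never changes.
    have e3 : k * rest A (take t A k Q) + k = k * rest A t := by rw [← e2]; ring
    refine ih _ (by omega) (Finset.mem_insert_of_mem hA) (by omega) (by omega) (by omega)
      (by omega) (fun Y hY => ?_) rfl
    rw [take_of_notMem hA hY]
    exact h5 Y fun h => hY (Finset.mem_insert_of_mem h)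

/-- A remaining outsider has so many cards that `k * rest` exceeds every correction term in the
invariant; this pays for moves of `A` while he has the majority. -/
theorem mul_rest_lower_bound {k p u ρ : ℕ} (hk : 4 ≤ k) (hp : 2 ≤ p) (hu : 8 * p * k ≤ u) (hρ : u ≤ ρ + p) :
    k * k + ρ + k * p + k * k * p ≤ k * ρ := by
  have h1 : 7 * (p * k) ≤ ρ := by nlinarith
  obtain ⟨l, rfl⟩ : ∃ l, k = l + 4 := ⟨k - 4, by omega⟩
  obtain ⟨q, rfl⟩ : ∃ q, p = q + 2 := ⟨p - 2, by omega⟩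
  have h2 := Nat.mul_le_mul_left (l + 3) h1
  nlinarith

/-- The case of blocks of moderate size: as long as `A` does not hold the majority of the unused
cards, the other players who know the common secret use up their cards first. -/
theorem Playable.of_small_blocks {k u : ℕ} (hk : 4 ≤ k) (hp : 2 ≤ p) (hku : 8 * p * k ≤ u)
    (hA : A ∈ J) (h1 : t A ≤ k * rest A t)
    (h2 : rest A t + k * active A t + k * k * Jᶜ.card ≤ k * t A)
    (h3 : ∀ X ∉ J, u + active A t ≤ t X + p) : Playable k A t J := by
  induction hn : rest A t + t A using Nat.strong_induction_on generalizing t J with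
  | h n ih =>
  subst hn
  by_cases hJ : J = Finset.univ
  · subst hJ
    refine Playable.final t h1 ?_
    change rest A t ≤ _
    omega
  obtain ⟨X, hXJ, hXA⟩ := exists_outsider hA hJ
  have hX := h3 X hXJ
  have hXr : t X ≤ rest A t := le_rest hXA
  have hpu : p + k < u := by nlinarith
  have hXpos : 0 < t X := by omega
  have hbound := mul_rest_lower_bound hk hp hku (ρ := rest A t) (by omega)
  have hcard : ∀ Q : Fin p, k * k * (insert Q J)ᶜ.card ≤ k * k * Jᶜ.card := fun Q =>
    Nat.mul_le_mul_left _ (Finset.card_le_card (Finset.compl_subset_compl.2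
      (Finset.subset_insert Q J)))
  have hcard' : ∀ Q ∉ J, k * k * (insert Q J)ᶜ.card + k * k = k * k * Jᶜ.card := by
    intro Q hQ
    have h := Finset.card_erase_add_one (Finset.mem_compl.2 hQ)
    rw [Finset.compl_insert, ← h]
    ring
  -- In the lower bound for `k * t A`, the term `k * active` pays for short blocks and `k * k *
  -- Jᶜ.card` for blocks by which `A` informs an outsider. Outsiders lose cards without being
  -- informed only to short blocks, each of which lowers `active`; hence the form of `h3`.
  have hact : ∀ P w Q, k * active A (take t P w Q) ≤ k * active A t := fun P w Q =>
    Nat.mul_le_mul_left _ active_take_le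
  have hout : ∀ P ∈ J, ∀ w Q, ∀ Y ∉ insert Q J,
      u + active A (take t P w Q) ≤ take t P w Q Y + p := by
    intro P hP w Q Y hY
    rw [take_of_notMem hP hY]
    have := h3 Y fun h => hY (Finset.mem_insert_of_mem h)
    have := active_take_le (A := A) (t := t) (P := P) (Q := Q) (w := w)
    omega
  have hkk : k ≤ k * k := Nat.le_mul_of_pos_left _ (by omega)
  have hkp : k ≤ k * p := Nat.le_mul_of_pos_right _ (by omega)
  have stepA : k ≤ t A → (∀ Q ≠ A, 0 < t Q → rest A t ≤ t A ∨ Q ∉ J) → Playable k A t J := by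
    intro hkA hcase
    refine Playable.step t J A hA k (by omega) le_rfl (Or.inl rfl) hkA ⟨X, hXA, hXpos⟩ ?_
    intro Q hQA hQ
    rw [if_pos rfl]
    have e1 := take_add hQA hkA hQ A
    have e2 := rest_take_add (A := A) hQA hkA hQ
    simp only [if_true, if_neg hQA.symm, ne_eq, not_true_eq_false, if_false, hQA,
      not_false_eq_true, add_zero] at e1 e2
    have e3 : k * rest A (take t A k Q) + k = k * rest A t := by rw [← e2]; ring
    have e4 : k * take t A k Q A + k * k = k * t A := by rw [← e1]; ring
    have e5 := hact A k Q
    refine ih _ (by omega) (Finset.mem_insert_of_mem hA) (by omega) ?_ (hout A hA k Q) rfl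
    rcases hcase Q hQA hQ with hmaj | hQJ
    · have e6 : k * rest A t ≤ k * t A := Nat.mul_le_mul_left k hmaj
      have e7 : k * active A t ≤ k * p := Nat.mul_le_mul_left k active_le
      have e8 : k * k * Jᶜ.card ≤ k * k * p :=
        Nat.mul_le_mul_left _ (by simpa using Finset.card_le_univ Jᶜ)
      have e9 := hcard Q
      omega
    · have := hcard' Q hQJ
      omega
  by_cases hmaj : rest A t ≤ t A
  · exact stepA (by omega) fun _ _ _ => Or.inl hmaj
  push Not at hmaj
  by_cases hB : ∃ B ∈ J, B ≠ A ∧ 0 < t B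
  · obtain ⟨B, hBJ, hBA, htB⟩ := hB
    have hXB : X ≠ B := fun h => hXJ (h ▸ hBJ)
    have stepB : ∀ w Q, Q ≠ B → 0 < t Q → 1 ≤ w → w ≤ k → w ≤ t B →
        take t B w Q A ≤ t A ∧ t A ≤ take t B w Q A + 1 ∧
        rest A (take t B w Q) + w ≤ rest A t ∧ rest A t ≤ rest A (take t B w Q) + w + 1 ∧
        take t B w Q A ≤ k * rest A (take t B w Q) ∧ k * t A ≤ k * take t B w Q A + k := by
      intro w Q hQB hQ hw hwk hwB
      have e1 := take_add hQB hwB hQ A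
      have e2 := rest_take_add (A := A) hQB hwB hQ
      rw [if_neg hBA.symm] at e1
      rw [if_pos hBA] at e2
      have e3 : take t B w Q A ≤ t A ∧ t A ≤ take t B w Q A + 1 := by split_ifs at e1 <;> omega
      have e4 : rest A (take t B w Q) + w ≤ rest A t ∧
          rest A t ≤ rest A (take t B w Q) + w + 1 := by split_ifs at e2 <;> omega
      have e5 : k * rest A t ≤ k * (rest A (take t B w Q) + k + 1) :=
        Nat.mul_le_mul_left k (by omega)
      have e6 : k * t A ≤ k * (take t B w Q A + 1) := Nat.mul_le_mul_left k e3.2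
      rw [mul_add, mul_add, mul_one] at e5
      rw [mul_add, mul_one] at e6
      exact ⟨e3.1, e3.2, e4.1, e4.2, by omega, e6⟩
    -- A full block costs `A` at most one card, thus at most `k` in `k * t A`, while the rest drops
    -- by at least `k`.
    by_cases hkB : k ≤ t B
    · refine Playable.step t J B hBJ k (by omega) le_rfl (Or.inl rfl) hkB ⟨X, hXB, hXpos⟩ ?_
      intro Q hQB hQ
      rw [if_pos rfl]
      obtain ⟨e1, e2, e3, e4, e5, e6⟩ := stepB k Q hQB hQ (by omega) le_rfl hkB
      have e7 := hcard Q
      have e8 := hact B k Q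
      exact ih _ (by omega) (Finset.mem_insert_of_mem hA) e5 (by omega) (hout B hBJ k Q) rfl
    -- A short block uses up the whole hand of `B`; the drop of `active` compensates for a card of
    -- `A`.
    · refine Playable.step t J B hBJ (t B) htB (by omega) (Or.inr hBA) le_rfl
        ⟨X, hXB, hXpos⟩ ?_
      intro Q hQB hQ
      rw [if_neg (by omega)]
      obtain ⟨e1, e2, e3, e4, e5, e6⟩ := stepB (t B) Q hQB hQ htB (by omega) le_rfl
      have e7 := active_take_lt (A := A) (t := t) (Q := Q) hBA htB
      have e8 : k * (active A (take t B (t B) Q) + 1) ≤ k * active A t :=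
        Nat.mul_le_mul_left k e7
      rw [mul_add, mul_one] at e8
      refine ih _ (by omega) hA e5 (by omega) (fun Y hY => ?_) rfl
      have e9 := h3 Y hY
      have e10 := take_add hQB le_rfl hQ Y
      rw [if_neg fun h : Y = B => hY (h ▸ hBJ)] at e10
      split_ifs at e10 <;> omega
  -- No informed player but `A` has cards left, so the foreign card in a block of `A` must belong to
  -- an outsider.
  · push Not at hB
    have e1 := hcard' X hXJ
    have hkA : k ≤ t A := le_of_mul_le_mul_left (a := k) (by omega) (by omega)
    refine stepA hkA fun Q hQA hQ => Or.inr fun hQJ => ?_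
    have := hB Q hQJ hQA
    omega

/-! ### Choice of the block size -/

/-- The numerical part of the argument: `n` cards, of which the largest hand contains `a` and the
others `r`, every hand containing at least `u`. -/
theorem solvable_of_bounds {s : Fin p → ℕ} {m n u : ℕ} (hp : 2 ≤ p) (hpm : p ≤ m)
    (hn : s A + rest A s = n) (hA : n ≤ m * s A) (hs : ∀ P, u ≤ s P) (hu : n ≤ 4 * m * u ^ 2)
    (hum : 20000 * m ^ 3 ≤ u) : Solvable s := by
  have hm : 2 ≤ m := hp.trans hpm
  have : Nontrivial (Fin p) := Fin.nontrivial_iff_two_le.2 hp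
  obtain ⟨B, hB⟩ := exists_ne A
  have hur : u ≤ rest A s := (hs B).trans (le_rest hB)
  set r := rest A s with hr
  have hm2 : 2 * m ≤ m ^ 2 := by nlinarith
  have hm3 : 2 * m ^ 2 ≤ m ^ 3 := by
    calc 2 * m ^ 2 ≤ m * m ^ 2 := Nat.mul_le_mul_right _ hm
      _ = m ^ 3 := by ring
  have hrpos : 0 < r := by omega
  have hdiv : n / r * r ≤ n := Nat.div_mul_le_self n r
  have hdiv' : n ≤ n / r * r + r := by
    have := Nat.lt_div_mul_add (a := n) hrpos
    omega
  generalize n / r = d at hdiv hdiv'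
  -- Here `d` is the integer part of `n / r`, so `k = 2 * m + d` ensures `s A ≤ k * r`, and the
  -- summand `2 * m` gives `2 * n ≤ k * s A`.
  by_cases hcase : 8 * m * (2 * m + d) ≤ u
  · refine Playable.solvable hp (k := 2 * m + d) (A := A) (Playable.of_small_blocks (u := u)
      (by omega) hp ?_ (by simp) ?_ ?_ ?_)
    · exact le_trans (by gcongr) hcase
    · nlinarith
    · have e1 : active A s ≤ m := active_le.trans hpm
      have e2 : ({A}ᶜ : Finset (Fin p)).card ≤ m := le_trans (by
        simpa using Finset.card_le_univ ({A}ᶜ : Finset (Fin p))) hpm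
      have e3 : (2 * m + d) * active A s ≤ (2 * m + d) * m := Nat.mul_le_mul_left _ e1
      have e4 : (2 * m + d) * (2 * m + d) * ({A}ᶜ : Finset (Fin p)).card ≤
          (2 * m + d) * (2 * m + d) * m := Nat.mul_le_mul_left _ e2
      have e5 : (2 * m + d) * m + (2 * m + d) * (2 * m + d) * m ≤ n := by
        generalize hk : 2 * m + d = k at hcase
        have h1 : d * (8 * m * k) ≤ n :=
          (Nat.mul_le_mul_left d (hcase.trans hur)).trans hdiv
        rcases le_total (2 * m) d with h | h
        · have h2 : k * k * m ≤ 2 * d * k * m := by gcongr; omega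
          have h3 : k * m ≤ d * (k * m) := Nat.le_mul_of_pos_left _ (by omega)
          nlinarith
        · have h2 : k * m ≤ 4 * m * m := by gcongr; omega
          have h3 : k * k * m ≤ 4 * m * (4 * m) * m := by gcongr <;> omega
          have h4 : 4 * m * m = 4 * m ^ 2 := by ring
          have h5 : 4 * m * (4 * m) * m = 16 * m ^ 3 := by ring
          omega
      have e6 : 2 * n ≤ (2 * m + d) * s A := by nlinarith
      change r + _ + _ ≤ _
      omega
    · intro X _
      have := hs X
      have := active_le (A := A) (t := s)
      omega
  · push Not at hcase
    have h1 : u ≤ 16 * (m * d) := by nlinarith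
    have h2 : u * r ≤ 16 * (m * n) := by
      calc u * r ≤ 16 * (m * d) * r := Nat.mul_le_mul_right r h1
        _ = 16 * (m * (d * r)) := by ring
        _ ≤ 16 * (m * n) := by gcongr
    have h3 : 2 * r ≤ n := by
      have : 32 * m * r ≤ u * r := Nat.mul_le_mul_right r (by omega)
      nlinarith
    -- The only use of the square root bound `n ≤ 4 * m * u ^ 2`: together with `u * r ≤ 16 * m * n`
    -- it makes `r` small enough.
    have h4 : 8 * (r * r) ≤ n * u := by
      have hu0 : 0 < u * u := by
        have : 0 < u := by omega
        positivity
      refine Nat.le_of_mul_le_mul_left ?_ hu0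
      calc u * u * (8 * (r * r)) = 8 * (u * r * (u * r)) := by ring
        _ ≤ 8 * (16 * (m * n) * (16 * (m * n))) := by gcongr
        _ = 2048 * m ^ 2 * n * n := by ring
        _ ≤ 2048 * m ^ 2 * (4 * m * u ^ 2) * n := by gcongr
        _ = 8192 * m ^ 3 * (u ^ 2 * n) := by ring
        _ ≤ u * (u ^ 2 * n) := by gcongr; omega
        _ = u * u * (n * u) := by ring
    have h5 : s A / r * r ≤ s A := Nat.div_mul_le_self _ _
    have h6 : s A < s A / r * r + r := Nat.lt_div_mul_add hrpos
    -- The block parameter `k = l + 1` satisfies `s A < k * r ≤ s A + r`.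
    generalize s A / r = l at h5 h6
    have h7 : 4 * r ≤ (l + 1) * u := by
      refine Nat.le_of_mul_le_mul_right ?_ hrpos
      have : s A * u ≤ (l + 1) * r * u := by gcongr; nlinarith
      nlinarith
    refine Playable.solvable hp (k := l + 1) (A := A) (Playable.of_majority (u := u) (r := r)
      (by omega) ?_ (by simp) ?_ ?_ le_rfl (by omega) fun X _ => hs X)
    · have : (l + 1) * 2 ≤ (l + 1) * u := Nat.mul_le_mul_left _ (by omega)
      omega
    · change _ ≤ (l + 1) * r
      nlinarith
    · change (l + 1) * r ≤ _
      nlinarith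

end

end SADI

theorem theorem4 (m : ℕ) :
    ∃ N : ℕ, ∀ (p : ℕ) (s : Fin p → ℕ), 2 ≤ p → p ≤ m →
      N < ∑ P, s P →
      (∀ P, (1 / 2 : ℝ) * Real.sqrt (((∑ Q, s Q : ℕ) : ℝ) / (m : ℝ)) ≤ (s P : ℝ)) →
      SADI.Solvable s := by
  -- This `N` forces the smallest hand to exceed `20000 * m ^ 3`, by the square root bound.
  refine ⟨4 * m * (20000 * m ^ 3) ^ 2, fun p s hp hpm hN hs => ?_⟩
  have hm : 0 < m := by omega
  have : Nonempty (Fin p) := ⟨⟨0, by omega⟩⟩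
  obtain ⟨A, -, hA⟩ := Finset.exists_max_image Finset.univ s Finset.univ_nonempty
  obtain ⟨B, -, hB⟩ := Finset.exists_min_image Finset.univ s Finset.univ_nonempty
  have hu : ∑ P, s P ≤ 4 * m * s B ^ 2 := by
    have h := hs B
    have hm' : (0 : ℝ) < m := by exact_mod_cast hm
    have h1 : ((∑ Q, s Q : ℕ) : ℝ) / m ≤ (2 * s B) ^ 2 := by
      rw [← Real.sqrt_le_left (by positivity)]
      linarith
    rw [div_le_iff₀ hm'] at h1
    have h2 : ((∑ Q, s Q : ℕ) : ℝ) ≤ ((4 * m * s B ^ 2 : ℕ) : ℝ) := by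
      refine h1.trans (le_of_eq ?_)
      push_cast
      ring
    exact_mod_cast h2
  refine SADI.solvable_of_bounds (A := A) (u := s B) hp hpm
    (Finset.add_sum_erase Finset.univ s (Finset.mem_univ A)) ?_ (fun P => hB P (by simp)) hu ?_
  · calc ∑ P, s P ≤ ∑ _P : Fin p, s A := Finset.sum_le_sum fun P _ => hA P (by simp)
      _ = p * s A := by simp
      _ ≤ m * s A := Nat.mul_le_mul_right _ hpm
  · by_contra! h
    have h1 : 4 * m * s B ^ 2 ≤ 4 * m * (20000 * m ^ 3) ^ 2 := by gcongr
    omega
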